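/- Let $n\ge 2$. For a Schwartz vector field $u=(u_1,\dots,u_n):\mathbb R^n\to\mathbb R^n$ let $$p=\sum_{l,k=1}^n(-\Delta)^{-1}\partial_l\partial_k(u_lu_k)$$ be the associated pressure, where $(-\Delta)^{-1}\partial_l\partial_k$ is the Fourier multiplier with symbol $-\xi_l\xi_k/|\xi|^2$; and write $\|f\|_{C^1}=\sup_x|f(x)|+\sup_x|Df(x)|$. Then for every $\varepsilon>0$ there exists a Schwartz vector field $u:\mathbb R^n\to\mathbb R^n$ with $\nabla\cdot u=0$ and $$\|\nabla u\|_{L^\infty(\mathbb R^n)}+\|u\|_{L^2(\mathbb R^n)}\le 1,$$ whose pressure $p$ is twice continuously differentiable and satisfies $$\|\nabla p\|_{C^1(\mathbb R^n)}>\frac1\varepsilon .$$ (Here $|Df(x)|$ and $|\nabla u(x)|$ are operator norms of the derivative matrices.) -/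

import Mathlib

open MeasureTheory
open scoped ENNReal FourierTransform SchwartzMap

/-- Euclidean space `ℝⁿ`. -/
abbrev RSpace (n : ℕ) : Type := EuclideanSpace ℝ (Fin n)

/-- The divergence `∇ · v = ∑ i, ∂ᵢ vᵢ` of a vector field on `ℝⁿ`. -/
noncomputable def divergence {n : ℕ} (v : RSpace n → RSpace n) (x : RSpace n) : ℝ :=
  ∑ i : Fin n, (fderiv ℝ v x (EuclideanSpace.single i (1 : ℝ))) i

/-- The symbol `-ξₗ ξₖ / |ξ|²` of the operator `(-Δ)⁻¹ ∂ₗ ∂ₖ`. It is homogeneous of degree zero, so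
it is the same for all normalisations of the Fourier transform. Its value at the single point
`ξ = 0` plays no role. -/
noncomputable def rieszSymbol {n : ℕ} (l k : Fin n) (ξ : RSpace n) : ℝ :=
  -(ξ l * ξ k) / ‖ξ‖ ^ 2

/-- `(-Δ)⁻¹ ∂ₗ ∂ₖ f`, the Fourier multiplier with symbol `-ξₗ ξₖ / |ξ|²` applied to a real-valued
function `f` (used for Schwartz `f`, where the inverse Fourier integral converges absolutely).
As the symbol is real and even, the inverse Fourier transform is real-valued
(`invNegLaplacianDeriv_im`), so taking the real part only changes the type. -/
noncomputable def invNegLaplacianDeriv {n : ℕ} (l k : Fin n) (f : RSpace n → ℝ) (x : RSpace n) :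
    ℝ :=
  (𝓕⁻ (fun ξ : RSpace n =>
    (rieszSymbol l k ξ : ℂ) * 𝓕 (fun y : RSpace n => (f y : ℂ)) ξ) x).re

theorem invNegLaplacianDeriv_im {n : ℕ} (l k : Fin n) (f : RSpace n → ℝ) (x : RSpace n) :
    (𝓕⁻ (fun ξ : RSpace n =>
      (rieszSymbol l k ξ : ℂ) * 𝓕 (fun y : RSpace n => (f y : ℂ)) ξ) x).im = 0 := by
  have hF : ∀ ξ : RSpace n, (starRingEnd ℂ) (𝓕 (fun y : RSpace n => (f y : ℂ)) ξ)
      = 𝓕 (fun y : RSpace n => (f y : ℂ)) (-ξ) := by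
    intro ξ
    rw [Real.fourier_eq', Real.fourier_eq', ← integral_conj]
    congr 1
    ext y
    simp [← Complex.exp_conj, map_ofNat]
  rw [← Complex.conj_eq_iff_im, Real.fourierInv_eq', ← integral_conj]
  rw [← integral_neg_eq_self]
  congr 1
  ext ξ
  simp [← Complex.exp_conj, map_ofNat, hF, rieszSymbol]

/-- The pressure `p = ∑ₗₖ (-Δ)⁻¹ ∂ₗ ∂ₖ (uₗ uₖ)` of the velocity field `u`. -/
noncomputable def pressure {n : ℕ} (u : RSpace n → RSpace n) (x : RSpace n) : ℝ :=
  ∑ l : Fin n, ∑ k : Fin n, invNegLaplacianDeriv l k (fun y => u y l * u y k) x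

/-- The norm `‖f‖_{C¹} = sup |f| + sup |Df|` of a `C¹` map, as an extended nonnegative real. -/
noncomputable def c1Norm {n : ℕ} (f : RSpace n → RSpace n) : ℝ≥0∞ :=
  (⨆ x, ‖f x‖ₑ) + ⨆ x, ‖fderiv ℝ f x‖ₑ

/-! The operators `(-Δ)⁻¹∂ₗ∂ₖ` have symbols homogeneous of degree zero, so they commute with
dilations but are not bounded on `L^∞`. The proof exploits this by adding up many scales at one
point.

Let `ψ` be a smooth divergence-free field supported in the ball of radius `R`, and let `|x₀| > R`.
The copies `r⁻ʲ ψ(rʲ x + x₀)` all have gradients of the same size, and for large `r` their supports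
are disjoint and avoid the origin. With `w = c ∑_{j<N} r⁻ʲ ψ(rʲ x + x₀)`, both `∇w` and the `L²`
norm of `w` are therefore bounded independently of `N`. Disjointness also removes the cross terms in
`w ⊗ w`, so the pressure of `w` is the sum of the rescaled pressures of `ψ`. Each summand
contributes the same matrix `c² D²p_ψ(x₀)` to the Hessian at the origin, and the total `N c²
D²p_ψ(x₀)` is unbounded in `N`, provided `D²p_ψ(x₀) ≠ 0`.

Such a point exists by nonlocality (`exists_fderiv_fderiv_pressure_ne_zero`). If `D²p_ψ` vanished
far away, `∂ᵢ²p_ψ` would have compact support and hence a smooth Fourier transform. Near the origin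
that transform is, up to a constant, `ξᵢ² ∑ ξₗξₖAₗₖ / |ξ|²` to leading order, where `A = ∫ ψ ⊗ ψ`.
This is a quadratic form only if `Aᵢᵢ = Aⱼⱼ`, and a suitable stream function gives `Aᵢᵢ ≠ Aⱼⱼ`. -/

/-! ### Second-order behaviour of a `C²` function along a ray. -/

open Filter Topology in
/-- If `t⁻² Q(t v)` converges to `a` as `t → 0⁺`, for a `C²` function `Q`, then `D²Q(0)(v, v) = 2a`. -/
theorem fderiv_fderiv_zero_apply_self_of_tendsto {E F : Type*} [NormedAddCommGroup E]
    [NormedSpace ℝ E] [NormedAddCommGroup F] [NormedSpace ℝ F] {Q : E → F}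
    (hQ : ContDiff ℝ 2 Q) {v : E} {a : F}
    (h : Tendsto (fun t : ℝ => (t ^ 2)⁻¹ • Q (t • v)) (𝓝[>] 0) (𝓝 a)) :
    fderiv ℝ (fderiv ℝ Q) 0 v v = (2 : ℝ) • a := by
  have hid : Tendsto (fun t : ℝ => t) (𝓝[>] 0) (𝓝 0) := tendsto_id.mono_left nhdsWithin_le_nhds
  have hpos : ∀ᶠ t : ℝ in 𝓝[>] 0, 0 < t := self_mem_nhdsWithin
  have hd : ∀ x, HasFDerivAt Q (fderiv ℝ Q x) x := fun x =>
    ((hQ.differentiable (by norm_num)) x).hasFDerivAt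
  have hdd : HasFDerivAt (fderiv ℝ Q) (fderiv ℝ (fderiv ℝ Q) 0) 0 :=
    (((hQ.fderiv_right (m := 1) (by norm_num)).differentiable (by norm_num)) 0).hasFDerivAt
  have hlin : Tendsto (fun t : ℝ => Q (t • v)) (𝓝[>] 0) (𝓝 (Q 0)) := by
    have : Tendsto (fun t : ℝ => Q (t • v)) (𝓝 0) (𝓝 (Q ((0 : ℝ) • v))) :=
      (hQ.continuous.comp (continuous_id.smul continuous_const)).tendsto 0
    rw [zero_smul] at this
    exact this.mono_left nhdsWithin_le_nhds
  have hQ0 : Q 0 = 0 := by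
    refine tendsto_nhds_unique hlin ?_
    have := (hid.pow 2).smul h
    simp only [ne_eq, OfNat.ofNat_ne_zero, not_false_eq_true, zero_pow, zero_smul] at this
    refine this.congr' ?_
    filter_upwards [hpos] with t ht
    rw [smul_smul, mul_inv_cancel₀ (by positivity), one_smul]
  have hQ1 : fderiv ℝ Q 0 v = 0 := by
    have h1 : HasDerivAt (fun t : ℝ => Q (t • v)) (fderiv ℝ Q 0 v) 0 := by
      have h2 : HasDerivAt (fun t : ℝ => t • v) v 0 := by
        simpa using (hasDerivAt_id (0 : ℝ)).smul_const v
      have h3 : HasFDerivAt Q (fderiv ℝ Q 0) ((0 : ℝ) • v) := by simpa using hd 0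
      exact h3.comp_hasDerivAt 0 h2
    have h4 := h1.tendsto_slope_zero_right
    refine tendsto_nhds_unique h4 ?_
    have := hid.smul h
    rw [zero_smul] at this
    refine this.congr' ?_
    filter_upwards [hpos] with t ht
    rw [smul_smul, zero_add, zero_smul, hQ0, sub_zero]
    congr 1
    field_simp
  -- With the first displacement equal to `0`, this is the Taylor expansion on the segment from `0`
  -- to `t • v`; since `Q` and its derivative along `v` vanish at `0`, only the Hessian term
  -- survives.
  have ht := Convex.taylor_approx_two_segment (s := Set.univ) (x := (0 : E)) (v := 0) (w := v)
    convex_univ (fun x _ => hd x) (Set.mem_univ _) hdd.hasFDerivWithinAt (by simp) (by simp)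
  simp only [smul_zero, add_zero, zero_add, hQ0, hQ1, sub_zero, map_zero,
    zero_apply] at ht
  have ht' : Tendsto (fun t : ℝ => (t ^ 2)⁻¹ • (Q (t • v) - (t ^ 2 / 2) •
      fderiv ℝ (fderiv ℝ Q) 0 v v)) (𝓝[>] 0) (𝓝 0) := ht.tendsto_inv_smul_nhds_zero
  have h5 : Tendsto (fun t : ℝ => (t ^ 2)⁻¹ • (Q (t • v) - (t ^ 2 / 2) •
      fderiv ℝ (fderiv ℝ Q) 0 v v)) (𝓝[>] 0)
      (𝓝 (a - (1 / 2 : ℝ) • fderiv ℝ (fderiv ℝ Q) 0 v v)) := by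
    refine (h.sub_const _).congr' ?_
    filter_upwards [hpos] with t ht
    rw [smul_sub, smul_smul]
    congr 2
    field_simp
  have h6 := sub_eq_zero.1 (tendsto_nhds_unique h5 ht')
  rw [h6, smul_smul]
  norm_num

/-! ### Derivatives of inverse Fourier transforms and Fourier inversion. -/

section FourierDecay

variable {V : Type*} [NormedAddCommGroup V] [InnerProductSpace ℝ V] [FiniteDimensional ℝ V]
  [MeasurableSpace V] [BorelSpace V]

theorem contDiff_fourierInv_of_integrable {M : V → ℂ} {N : ℕ∞}
    (hM : ∀ k : ℕ, Integrable (fun ξ => ‖ξ‖ ^ k * ‖M ξ‖)) : ContDiff ℝ N (𝓕⁻ M) := by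
  have h1 : 𝓕⁻ M = (𝓕 M) ∘ (fun x => -x) := by
    ext x; exact Real.fourierInv_eq_fourier_neg _ _
  rw [h1]
  exact (Real.contDiff_fourier fun n _ => hM n).comp contDiff_neg

theorem fderiv_fourierInv_apply {M : V → ℂ} (hM0 : Integrable M)
    (hM1 : Integrable (fun ξ => ‖ξ‖ * ‖M ξ‖)) (x v : V) :
    fderiv ℝ (𝓕⁻ M) x v
      = 𝓕⁻ (fun ξ => (2 * Real.pi * Complex.I) * (inner ℝ ξ v : ℝ) * M ξ) x := by
  have h1 : 𝓕⁻ M = (𝓕 M) ∘ (fun x => -x) := by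
    ext x; exact Real.fourierInv_eq_fourier_neg _ _
  have h2 : HasFDerivAt (𝓕⁻ M)
      ((𝓕 (VectorFourier.fourierSMulRight (innerSL ℝ) M) (-x)).comp
        (-(ContinuousLinearMap.id ℝ V))) x := by
    rw [h1]
    exact (Real.hasFDerivAt_fourier hM0 hM1 (-x)).comp x (hasFDerivAt_id x).neg
  rw [h2.fderiv, Real.fourierInv_eq_fourier_neg]
  simp only [ContinuousLinearMap.comp_apply, neg_apply,
    ContinuousLinearMap.id_apply, map_neg]
  have hint : Integrable (VectorFourier.fourierSMulRight (innerSL ℝ) M) := by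
    refine (hM1.const_mul (2 * Real.pi * ‖innerSL ℝ (E := V)‖)).mono'
      hM0.1.fourierSMulRight (.of_forall fun ξ => ?_)
    refine (VectorFourier.norm_fourierSMulRight_le _ _ _).trans (le_of_eq (by ring))
  have key := Real.fourier_continuousLinearMap_apply hint (a := v) (v := -x)
  rw [key, Real.fourier_eq, Real.fourier_eq, ← integral_neg]
  congr 1
  ext ξ
  simp only [VectorFourier.fourierSMulRight_apply, ← smul_neg]
  rw [show (innerSL ℝ ξ) v = inner ℝ ξ v from rfl]
  congr 1
  simp only [Complex.real_smul, smul_eq_mul]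
  ring

theorem fderiv_fderiv_fourierInv_apply {M : V → ℂ} (hm : AEStronglyMeasurable M)
    (hM : ∀ k : ℕ, Integrable (fun ξ => ‖ξ‖ ^ k * ‖M ξ‖)) (x v : V) :
    fderiv ℝ (fun y => fderiv ℝ (𝓕⁻ M) y v) x v
      = 𝓕⁻ (fun ξ => (2 * Real.pi * Complex.I) ^ 2 * ((inner ℝ ξ v : ℝ) : ℂ) ^ 2 * M ξ :
        V → ℂ) x := by
  have hM0 : Integrable M := (integrable_norm_iff hm).1 (by simpa using hM 0)
  have hM1 : Integrable (fun ξ => ‖ξ‖ * ‖M ξ‖) := by simpa using hM 1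
  have hc : Continuous fun ξ : V => (2 * Real.pi * Complex.I) * ((inner ℝ ξ v : ℝ) : ℂ) := by
    fun_prop
  have hb : ∀ ξ : V, ‖(2 * Real.pi * Complex.I) * ((inner ℝ ξ v : ℝ) : ℂ) * M ξ‖
      ≤ 2 * Real.pi * ‖v‖ * (‖ξ‖ * ‖M ξ‖) := by
    intro ξ
    have := norm_inner_le_norm (𝕜 := ℝ) ξ v
    have hp := Real.pi_pos.le
    rw [norm_mul, norm_mul, norm_mul, norm_mul, Complex.norm_real, Complex.norm_real,
      Complex.norm_I, Real.norm_of_nonneg hp]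
    simp only [Complex.norm_ofNat, mul_one]
    calc 2 * Real.pi * ‖inner ℝ ξ v‖ * ‖M ξ‖ ≤ 2 * Real.pi * (‖ξ‖ * ‖v‖) * ‖M ξ‖ := by gcongr
      _ = _ := by ring
  simp only [fderiv_fourierInv_apply hM0 hM1]
  have hmeas := hc.aestronglyMeasurable.mul hm
  rw [fderiv_fourierInv_apply]
  · refine congrArg (fun f : V → ℂ => 𝓕⁻ f x) (funext fun ξ => ?_)
    ring
  · exact (hM1.const_mul _).mono' hmeas (.of_forall hb)
  · refine ((hM 2).const_mul (2 * Real.pi * ‖v‖)).mono'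
      (continuous_norm.aestronglyMeasurable.mul hmeas.norm) (.of_forall fun ξ => ?_)
    rw [norm_mul, norm_norm, norm_norm]
    calc _ ≤ ‖ξ‖ * (2 * Real.pi * ‖v‖ * (‖ξ‖ * ‖M ξ‖)) := by gcongr; exact hb ξ
      _ = _ := by ring

/-- If the second derivative of `𝓕⁻ M` in the direction `v` vanishes outside a ball, then
`⟪ξ, v⟫² M ξ` agrees at the continuity points of `M` with a `C²` function. -/
theorem exists_contDiff_eq_of_fderiv_fderiv_fourierInv_eq_zero {M : V → ℂ}
    (hm : AEStronglyMeasurable M) (hM : ∀ k : ℕ, Integrable (fun ξ => ‖ξ‖ ^ k * ‖M ξ‖))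
    (v : V) (R : ℝ)
    (h : ∀ x, R < ‖x‖ → fderiv ℝ (fun y => fderiv ℝ (𝓕⁻ M) y v) x v = 0) :
    ∃ Q : V → ℂ, ContDiff ℝ 2 Q ∧
      ∀ ξ, ContinuousAt M ξ → Q ξ = ((inner ℝ ξ v : ℝ) : ℂ) ^ 2 * M ξ := by
  set q : V → ℂ := fun ξ =>
    (2 * Real.pi * Complex.I) ^ 2 * ((inner ℝ ξ v : ℝ) : ℂ) ^ 2 * M ξ with hq
  have hc : Continuous fun ξ : V =>
      (2 * Real.pi * Complex.I) ^ 2 * ((inner ℝ ξ v : ℝ) : ℂ) ^ 2 := by fun_prop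
  have hqint : Integrable q := by
    refine ((hM 2).const_mul (‖(2 * Real.pi * Complex.I) ^ 2‖ * ‖v‖ ^ 2)).mono'
      (hc.aestronglyMeasurable.mul hm) (.of_forall fun ξ => ?_)
    have := norm_inner_le_norm (𝕜 := ℝ) ξ v
    rw [hq]
    simp only [norm_mul, norm_pow, Complex.norm_real]
    calc _ ≤ _ * (‖ξ‖ * ‖v‖) ^ 2 * ‖M ξ‖ := by gcongr
      _ = _ := by ring
  have hG : ∀ x, R < ‖x‖ → 𝓕⁻ q x = 0 := fun x hx => by
    rw [← fderiv_fderiv_fourierInv_apply hm hM, h x hx]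
  have hGs : HasCompactSupport (𝓕⁻ q) := by
    refine HasCompactSupport.intro (isCompact_closedBall (0 : V) R) fun x hx => hG x ?_
    simpa using hx
  have hGc : Continuous (𝓕⁻ q) := by
    have h1 : 𝓕⁻ q = (𝓕 q) ∘ (fun x => -x) := by
      ext x; exact Real.fourierInv_eq_fourier_neg _ _
    rw [h1]
    exact (VectorFourier.fourierIntegral_continuous Real.continuous_fourierChar
      (by exact continuous_inner) hqint).comp continuous_neg
  -- A continuous compactly supported function has finite moments of every order, so its transform
  -- is smooth; up to the factor `(2πi)²` this is the required `Q`.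
  have hQ : ContDiff ℝ ((2 : ℕ∞) : WithTop ℕ∞) (𝓕 (𝓕⁻ q)) :=
    Real.contDiff_fourier fun k _ =>
      ((continuous_norm.pow k).mul hGc.norm).integrable_of_hasCompactSupport hGs.norm.mul_left
  have hGi : Integrable (𝓕⁻ q) := hGc.integrable_of_hasCompactSupport hGs
  have hGi' : Integrable (𝓕 q) := by
    have h1 : 𝓕 q = fun x => 𝓕⁻ q (-x) := by
      ext x; rw [Real.fourierInv_eq_fourier_neg, neg_neg]
    rw [h1]
    exact hGi.comp_neg
  have hne : (2 * Real.pi * Complex.I) ^ 2 ≠ 0 := by simp [Real.pi_ne_zero]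
  refine ⟨fun ξ => ((2 * Real.pi * Complex.I) ^ 2)⁻¹ * 𝓕 (𝓕⁻ q) ξ, contDiff_const.mul hQ,
    fun ξ hξ => ?_⟩
  beta_reduce
  -- Pointwise inversion needs continuity of `q` at `ξ`; in the application `M` may jump at the
  -- origin.
  rw [hqint.fourier_fourierInv_eq hGi' (hc.continuousAt.mul hξ), hq]
  simp only
  generalize (2 * Real.pi * Complex.I) ^ 2 = c at hne
  field_simp

end FourierDecay

/-! ### The multiplier `(-Δ)⁻¹∂ₗ∂ₖ`: bounds, affine covariance, linearity. -/

section RieszMultiplier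

variable {n : ℕ}

theorem abs_rieszSymbol_le_one (l k : Fin n) (ξ : RSpace n) : |rieszSymbol l k ξ| ≤ 1 := by
  have h1 : |ξ l| ≤ ‖ξ‖ := PiLp.norm_apply_le ξ l
  have h2 : |ξ k| ≤ ‖ξ‖ := PiLp.norm_apply_le ξ k
  rw [rieszSymbol, abs_div, abs_neg, abs_mul, abs_of_nonneg (sq_nonneg ‖ξ‖)]
  refine div_le_one_of_le₀ ?_ (sq_nonneg _)
  rw [sq]
  gcongr

theorem continuousAt_rieszSymbol (l k : Fin n) {ξ : RSpace n} (hξ : ξ ≠ 0) :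
    ContinuousAt (rieszSymbol l k) ξ := by
  unfold rieszSymbol
  have : ‖ξ‖ ^ 2 ≠ 0 := by simpa using hξ
  fun_prop (disch := assumption)

theorem measurable_rieszSymbol (l k : Fin n) : Measurable (rieszSymbol l k) := by
  unfold rieszSymbol
  fun_prop

theorem rieszSymbol_smul (l k : Fin n) {t : ℝ} (ht : t ≠ 0) (ξ : RSpace n) :
    rieszSymbol l k (t • ξ) = rieszSymbol l k ξ := by
  simp only [rieszSymbol, norm_smul, PiLp.smul_apply, smul_eq_mul, mul_pow, Real.norm_eq_abs,
    sq_abs]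
  rw [show t * ξ l * (t * ξ k) = t ^ 2 * (ξ l * ξ k) by ring, ← mul_neg,
    mul_div_mul_left _ _ (pow_ne_zero 2 ht)]

/-- The Fourier multiplier with symbol `rieszSymbol l k` acting on complex-valued functions. -/
noncomputable def rieszMultiplier (l k : Fin n) (f : RSpace n → ℂ) : RSpace n → ℂ :=
  𝓕⁻ (fun ξ : RSpace n => (rieszSymbol l k ξ : ℂ) * 𝓕 f ξ)

theorem ofReal_invNegLaplacianDeriv (l k : Fin n) (f : RSpace n → ℝ) (x : RSpace n) :
    (invNegLaplacianDeriv l k f x : ℂ) = rieszMultiplier l k (fun y => (f y : ℂ)) x := by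
  have := invNegLaplacianDeriv_im l k f x
  exact Complex.ext rfl this.symm

theorem fourier_comp_smul_add (f : RSpace n → ℂ) {a : ℝ} (ha : 0 < a) (x₀ ξ : RSpace n) :
    𝓕 (fun y => f (a • y + x₀)) (a • ξ)
      = ((a ^ n)⁻¹ : ℝ) • (Real.fourierChar (inner ℝ x₀ ξ) • 𝓕 f ξ) := by
  have h1 : ∀ y : RSpace n, Real.fourierChar (-(inner ℝ y (a • ξ))) • f (a • y + x₀)
      = (fun z => Real.fourierChar (inner ℝ x₀ ξ) •
          (fun w => Real.fourierChar (-(inner ℝ w ξ)) • f w) (z + x₀)) (a • y) := by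
    intro y
    simp only [smul_smul, ← AddChar.map_add_eq_mul]
    congr 2
    rw [inner_add_left, inner_smul_left, inner_smul_right]
    simp
  rw [Real.fourier_eq, Real.fourier_eq]
  rw [integral_congr_ae (.of_forall h1), Measure.integral_comp_smul_of_nonneg volume
    (fun z => Real.fourierChar (inner ℝ x₀ ξ) •
      (fun w => Real.fourierChar (-(inner ℝ w ξ)) • f w) (z + x₀)) a (hR := ha.le),
    finrank_euclideanSpace_fin]
  congr 1
  simp only [Circle.smul_def, smul_eq_mul, integral_const_mul]
  congr 1
  exact integral_add_right_eq_self (μ := volume)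
    (fun w => (Real.fourierChar (-(inner ℝ w ξ)) : ℂ) * f w) x₀

/-- A translation multiplies the Fourier transform by a phase and a dilation rescales the frequency.
A multiplier of degree zero commutes with both. -/
theorem rieszMultiplier_comp_smul_add (l k : Fin n) (f : RSpace n → ℂ) {a : ℝ} (ha : 0 < a)
    (x₀ x : RSpace n) :
    rieszMultiplier l k (fun y => f (a • y + x₀)) x = rieszMultiplier l k f (a • x + x₀) := by
  have hn : a ^ n ≠ 0 := by positivity
  -- The substitution `ξ ↦ a • ξ` has Jacobian `aⁿ`, which cancels the factor `a⁻ⁿ` in the transform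
  -- of the dilated function.
  have h := Measure.integral_comp_smul_of_nonneg (volume : Measure (RSpace n))
    (fun ξ => Real.fourierChar (inner ℝ ξ x) •
      ((rieszSymbol l k ξ : ℂ) * 𝓕 (fun y => f (a • y + x₀)) ξ)) a (hR := ha.le)
  rw [finrank_euclideanSpace_fin, eq_inv_smul_iff₀ hn, ← integral_smul] at h
  rw [rieszMultiplier, rieszMultiplier, Real.fourierInv_eq, Real.fourierInv_eq, ← h]
  congr 1
  ext ξ
  rw [rieszSymbol_smul l k ha.ne', fourier_comp_smul_add f ha,
    inner_add_right, AddChar.map_add_eq_mul, real_inner_comm x₀ ξ, inner_smul_left,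
    inner_smul_right]
  simp only [Circle.smul_def, Complex.real_smul, smul_eq_mul, Circle.coe_mul, conj_trivial,
    Complex.ofReal_inv]
  have hn' : ((a ^ n : ℝ) : ℂ) ≠ 0 := by exact_mod_cast hn
  field_simp

theorem integrable_pow_mul_rieszSymbol_mul_fourier (l k : Fin n) (f : 𝓢(RSpace n, ℂ)) (m : ℕ) :
    Integrable (fun ξ => ‖ξ‖ ^ m * ‖(rieszSymbol l k ξ : ℂ) * 𝓕 (f : RSpace n → ℂ) ξ‖) := by
  have hc : Continuous (𝓕 (f : RSpace n → ℂ)) := by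
    rw [← SchwartzMap.fourier_coe]; exact (𝓕 f).continuous
  have hm := (Complex.measurable_ofReal.comp (measurable_rieszSymbol l k)).mul hc.measurable
  have h := (𝓕 f).integrable_pow_mul volume m
  rw [SchwartzMap.fourier_coe] at h
  refine h.mono' ((measurable_norm.pow_const m).mul hm.norm).aestronglyMeasurable
    (.of_forall fun ξ => ?_)
  rw [norm_mul, norm_pow, norm_norm, norm_norm, norm_mul, Complex.norm_real]
  have := abs_rieszSymbol_le_one l k ξ
  rw [← Real.norm_eq_abs] at this
  calc ‖ξ‖ ^ m * (‖rieszSymbol l k ξ‖ * ‖𝓕 (f : RSpace n → ℂ) ξ‖)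
      ≤ ‖ξ‖ ^ m * (1 * ‖𝓕 (f : RSpace n → ℂ) ξ‖) := by gcongr
    _ = _ := by rw [one_mul]

theorem measurable_rieszSymbol_mul_fourier (l k : Fin n) (f : 𝓢(RSpace n, ℂ)) :
    Measurable (fun ξ => (rieszSymbol l k ξ : ℂ) * 𝓕 (f : RSpace n → ℂ) ξ) := by
  have hc : Continuous (𝓕 (f : RSpace n → ℂ)) := by
    rw [← SchwartzMap.fourier_coe]; exact (𝓕 f).continuous
  exact (Complex.measurable_ofReal.comp (measurable_rieszSymbol l k)).mul hc.measurable

theorem integrable_rieszSymbol_mul_fourier (l k : Fin n) (f : 𝓢(RSpace n, ℂ)) :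
    Integrable (fun ξ => (rieszSymbol l k ξ : ℂ) * 𝓕 (f : RSpace n → ℂ) ξ) := by
  have := integrable_pow_mul_rieszSymbol_mul_fourier l k f 0
  simp only [pow_zero, one_mul] at this
  exact (integrable_norm_iff (measurable_rieszSymbol_mul_fourier l k f).aestronglyMeasurable).1 this

theorem fourierInv_finset_sum {V ι : Type*} [NormedAddCommGroup V] [InnerProductSpace ℝ V]
    [FiniteDimensional ℝ V] [MeasurableSpace V] [BorelSpace V] (s : Finset ι) (g : ι → V → ℂ)
    (hg : ∀ i ∈ s, Integrable (g i)) (x : V) :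
    𝓕⁻ (fun ξ => ∑ i ∈ s, g i ξ : V → ℂ) x = ∑ i ∈ s, 𝓕⁻ (g i) x := by
  simp only [Real.fourierInv_eq_fourier_neg, Real.fourier_eq, Finset.smul_sum]
  exact integral_finsetSum s fun i hi => (Real.fourierIntegral_convergent_iff _).2 (hg i hi)

theorem rieszMultiplier_sum {ι : Type*} (s : Finset ι) (l k : Fin n) (c : ι → ℝ)
    (f : ι → 𝓢(RSpace n, ℂ)) (x : RSpace n) :
    rieszMultiplier l k (fun y => ∑ i ∈ s, (c i : ℂ) * f i y) x
      = ∑ i ∈ s, (c i : ℂ) * rieszMultiplier l k (f i) x := by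
  have h2 : 𝓕 (fun y => ∑ i ∈ s, (c i : ℂ) * f i y : RSpace n → ℂ)
      = fun ξ => ∑ i ∈ s, (c i : ℂ) * 𝓕 (f i : RSpace n → ℂ) ξ := by
    ext ξ
    simp only [Real.fourier_eq, Finset.smul_sum]
    rw [integral_finsetSum]
    · refine Finset.sum_congr rfl fun i _ => ?_
      rw [← integral_const_mul]
      congr 1
      ext y
      simp only [Circle.smul_def, smul_eq_mul]
      ring
    · exact fun i _ => (Real.fourierIntegral_convergent_iff _).2 ((f i).integrable.const_mul _)
  have h3 : (fun ξ => (rieszSymbol l k ξ : ℂ) *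
        𝓕 (fun y => ∑ i ∈ s, (c i : ℂ) * f i y : RSpace n → ℂ) ξ)
      = fun ξ => ∑ i ∈ s, (c i : ℂ) * ((rieszSymbol l k ξ : ℂ) * 𝓕 (f i : RSpace n → ℂ) ξ) := by
    ext ξ
    rw [h2, Finset.mul_sum]
    exact Finset.sum_congr rfl fun i _ => by ring
  rw [rieszMultiplier, h3, fourierInv_finset_sum]
  · refine Finset.sum_congr rfl fun i _ => ?_
    rw [rieszMultiplier, Real.fourierInv_eq, Real.fourierInv_eq, ← integral_const_mul]
    congr 1
    ext y
    simp only [Circle.smul_def, smul_eq_mul]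
    ring
  · exact fun i _ => (integrable_rieszSymbol_mul_fourier l k (f i)).const_mul _

end RieszMultiplier

/-! ### Regularity, scaling and nonlocality of the pressure. -/

section Pressure

variable {n : ℕ}

theorem exists_schwartzMap_stress {u : RSpace n → RSpace n} (hu : ContDiff ℝ (⊤ : ℕ∞) u)
    (hc : HasCompactSupport u) (l k : Fin n) (a : ℝ) (ha : a ≠ 0) (x₀ : RSpace n) :
    ∃ f : 𝓢(RSpace n, ℂ),
      (f : RSpace n → ℂ) = fun y => ((u (a • y + x₀) l * u (a • y + x₀) k : ℝ) : ℂ) := by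
  have hl : ∀ i, ContDiff ℝ (⊤ : ℕ∞) fun y => u (a • y + x₀) i := fun i =>
    (contDiff_piLp_apply (i := i) 2).comp
      (hu.comp ((contDiff_id.const_smul a).add contDiff_const))
  have h1 : ContDiff ℝ (⊤ : ℕ∞) fun y => ((u (a • y + x₀) l * u (a • y + x₀) k : ℝ) : ℂ) :=
    Complex.ofRealCLM.contDiff.comp ((hl l).mul (hl k))
  have h2 : HasCompactSupport fun y => u (a • y + x₀) :=
    hc.comp_homeomorph ((Homeomorph.smulOfNeZero a ha).trans (Homeomorph.addRight x₀))
  have h3 : HasCompactSupport fun y => ((u (a • y + x₀) l * u (a • y + x₀) k : ℝ) : ℂ) :=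
    h2.comp_left (g := fun v : RSpace n => ((v l * v k : ℝ) : ℂ)) (by simp)
  exact ⟨h3.toSchwartzMap h1, rfl⟩

/-- The Fourier transform of the pressure of `u`. -/
noncomputable def pressureSymbol (u : RSpace n → RSpace n) (ξ : RSpace n) : ℂ :=
  ∑ l : Fin n, ∑ k : Fin n,
    (rieszSymbol l k ξ : ℂ) * 𝓕 (fun y : RSpace n => ((u y l * u y k : ℝ) : ℂ)) ξ

theorem exists_schwartzMap_stress_id {u : RSpace n → RSpace n} (hu : ContDiff ℝ (⊤ : ℕ∞) u)
    (hc : HasCompactSupport u) (l k : Fin n) :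
    ∃ f : 𝓢(RSpace n, ℂ), (f : RSpace n → ℂ) = fun y => ((u y l * u y k : ℝ) : ℂ) := by
  simpa using exists_schwartzMap_stress hu hc l k 1 one_ne_zero 0

theorem ofReal_pressure_eq_sum (u : RSpace n → RSpace n) (x : RSpace n) :
    (pressure u x : ℂ)
      = ∑ l, ∑ k, rieszMultiplier l k (fun y => ((u y l * u y k : ℝ) : ℂ)) x := by
  simp only [pressure, Complex.ofReal_sum, ofReal_invNegLaplacianDeriv]

theorem ofReal_pressure {u : RSpace n → RSpace n} (hu : ContDiff ℝ (⊤ : ℕ∞) u)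
    (hc : HasCompactSupport u) :
    (fun x => (pressure u x : ℂ)) = 𝓕⁻ (pressureSymbol u) := by
  choose f hf using exists_schwartzMap_stress_id hu hc
  ext x
  rw [ofReal_pressure_eq_sum]
  unfold pressureSymbol
  simp only [← hf]
  rw [fourierInv_finset_sum]
  · refine Finset.sum_congr rfl fun l _ => ?_
    rw [fourierInv_finset_sum]
    · rfl
    · exact fun k _ => integrable_rieszSymbol_mul_fourier l k (f l k)
  · exact fun l _ => integrable_finsetSum _ fun k _ =>
      integrable_rieszSymbol_mul_fourier l k (f l k)

theorem measurable_pressureSymbol {u : RSpace n → RSpace n} (hu : ContDiff ℝ (⊤ : ℕ∞) u)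
    (hc : HasCompactSupport u) : Measurable (pressureSymbol u) := by
  choose f hf using exists_schwartzMap_stress_id hu hc
  unfold pressureSymbol
  simp only [← hf]
  exact Finset.measurable_fun_sum _ fun l _ => Finset.measurable_fun_sum _ fun k _ =>
    measurable_rieszSymbol_mul_fourier l k (f l k)

theorem integrable_pow_mul_pressureSymbol {u : RSpace n → RSpace n} (hu : ContDiff ℝ (⊤ : ℕ∞) u)
    (hc : HasCompactSupport u) (m : ℕ) :
    Integrable (fun ξ => ‖ξ‖ ^ m * ‖pressureSymbol u ξ‖) := by
  have hmeas := measurable_pressureSymbol hu hc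
  choose f hf using exists_schwartzMap_stress_id hu hc
  have h := integrable_finsetSum Finset.univ fun l _ => integrable_finsetSum Finset.univ fun k _ =>
    integrable_pow_mul_rieszSymbol_mul_fourier l k (f l k) m
  refine h.mono' ((measurable_norm.pow_const m).mul hmeas.norm).aestronglyMeasurable
    (.of_forall fun ξ => ?_)
  rw [norm_mul, norm_pow, norm_norm, norm_norm]
  simp only [← Finset.mul_sum]
  gcongr
  unfold pressureSymbol
  refine (norm_sum_le _ _).trans (Finset.sum_le_sum fun l _ => (norm_sum_le _ _).trans ?_)
  simp only [hf]
  exact le_rfl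

theorem contDiff_pressure {u : RSpace n → RSpace n} (hu : ContDiff ℝ (⊤ : ℕ∞) u)
    (hc : HasCompactSupport u) : ContDiff ℝ 2 (pressure u) := by
  have h1 : ContDiff ℝ ((2 : ℕ∞) : WithTop ℕ∞) (𝓕⁻ (pressureSymbol u)) :=
    contDiff_fourierInv_of_integrable (integrable_pow_mul_pressureSymbol hu hc)
  rw [← ofReal_pressure hu hc] at h1
  exact Complex.reCLM.contDiff.comp h1

theorem continuousAt_pressureSymbol {u : RSpace n → RSpace n} (hu : ContDiff ℝ (⊤ : ℕ∞) u)
    (hc : HasCompactSupport u) {ξ : RSpace n} (hξ : ξ ≠ 0) :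
    ContinuousAt (pressureSymbol u) ξ := by
  choose f hf using exists_schwartzMap_stress_id hu hc
  unfold pressureSymbol
  simp only [← hf]
  refine tendsto_finsetSum _ fun l _ => tendsto_finsetSum _ fun k _ => ?_
  have hcont : Continuous (𝓕 (f l k : RSpace n → ℂ)) := by
    rw [← SchwartzMap.fourier_coe]; exact (𝓕 (f l k)).continuous
  exact (Complex.continuous_ofReal.continuousAt.comp (continuousAt_rieszSymbol l k hξ)).mul
    hcont.continuousAt

open Filter Topology in
-- The Riesz symbols are constant along the ray and the transforms of `uₗuₖ` tend to their
-- integrals. The limit may depend on the direction of `v`, which is the singularity exploited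
-- below.
theorem tendsto_pressureSymbol_smul {u : RSpace n → RSpace n} (hu : ContDiff ℝ (⊤ : ℕ∞) u)
    (hc : HasCompactSupport u) (v : RSpace n) :
    Tendsto (fun t : ℝ => pressureSymbol u (t • v)) (𝓝[>] 0)
      (𝓝 ((∑ l, ∑ k, rieszSymbol l k v * ∫ y, u y l * u y k : ℝ) : ℂ)) := by
  choose f hf using exists_schwartzMap_stress_id hu hc
  have key : Tendsto (fun t : ℝ => ∑ l, ∑ k,
      (rieszSymbol l k v : ℂ) * 𝓕 (f l k : RSpace n → ℂ) (t • v)) (𝓝[>] 0)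
      (𝓝 ((∑ l, ∑ k, rieszSymbol l k v * ∫ y, u y l * u y k : ℝ) : ℂ)) := by
    push_cast
    refine tendsto_finsetSum _ fun l _ => tendsto_finsetSum _ fun k _ => ?_
    have hcont : Continuous (𝓕 (f l k : RSpace n → ℂ)) := by
      rw [← SchwartzMap.fourier_coe]; exact (𝓕 (f l k)).continuous
    have h0 : 𝓕 (f l k : RSpace n → ℂ) 0 = ((∫ y, u y l * u y k : ℝ) : ℂ) := by
      rw [Real.fourier_eq, ← integral_complex_ofReal]
      simp [hf]
    have h1 : Tendsto (fun t : ℝ => 𝓕 (f l k : RSpace n → ℂ) (t • v)) (𝓝 0)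
        (𝓝 (𝓕 (f l k : RSpace n → ℂ) ((0 : ℝ) • v))) :=
      (hcont.comp (continuous_id.smul continuous_const)).tendsto 0
    rw [zero_smul, h0] at h1
    exact (h1.mono_left nhdsWithin_le_nhds).const_mul _
  refine key.congr' ?_
  filter_upwards [self_mem_nhdsWithin] with t ht
  unfold pressureSymbol
  simp only [← hf, rieszSymbol_smul _ _ (ne_of_gt ht)]

/-- The pressure is linear in the tensor `u ⊗ u`, so a decomposition of that tensor without cross
terms passes to the pressure. -/
theorem pressure_eq_sum_of_mul_eq_sum {ι : Type*} (s : Finset ι) {u ψ : RSpace n → RSpace n}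
    (hψ : ContDiff ℝ (⊤ : ℕ∞) ψ) (hc : HasCompactSupport ψ) (c a : ι → ℝ) (ha : ∀ i, 0 < a i)
    (x₀ : RSpace n)
    (h : ∀ l k y, u y l * u y k
      = ∑ i ∈ s, c i * (ψ (a i • y + x₀) l * ψ (a i • y + x₀) k)) (x : RSpace n) :
    pressure u x = ∑ i ∈ s, c i * pressure ψ (a i • x + x₀) := by
  have hf := fun l k i => exists_schwartzMap_stress hψ hc l k (a i) (ha i).ne' x₀
  choose f hf using hf
  rw [← Complex.ofReal_inj]
  push_cast
  simp only [ofReal_pressure_eq_sum]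
  have h1 : ∀ l k, rieszMultiplier l k (fun y => ((u y l * u y k : ℝ) : ℂ)) x
      = ∑ i ∈ s, (c i : ℂ) *
        rieszMultiplier l k (fun y => ((ψ y l * ψ y k : ℝ) : ℂ)) (a i • x + x₀) := by
    intro l k
    have h2 : (fun y => ((u y l * u y k : ℝ) : ℂ)) = fun y => ∑ i ∈ s, (c i : ℂ) * f l k i y := by
      ext y
      rw [h]
      simp [hf]
    rw [h2, rieszMultiplier_sum]
    refine Finset.sum_congr rfl fun i _ => ?_
    rw [hf, rieszMultiplier_comp_smul_add l k
      (fun y => ((ψ y l * ψ y k : ℝ) : ℂ)) (ha i)]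
  simp only [h1, Finset.mul_sum]
  rw [Finset.sum_comm (s := s)]
  refine Finset.sum_congr rfl fun l _ => ?_
  rw [Finset.sum_comm (s := s)]

/-- If the stress tensor `∫ u ⊗ u` is not a multiple of the identity, then the Hessian of the
pressure of `u` does not vanish identically outside any ball. -/
theorem exists_fderiv_fderiv_pressure_ne_zero {u : RSpace n → RSpace n} (hu : ContDiff ℝ (⊤ : ℕ∞) u)
    (hc : HasCompactSupport u) {i j : Fin n} (hij : i ≠ j)
    (hA : ∫ y, u y i * u y i ≠ ∫ y, u y j * u y j) (R : ℝ) :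
    ∃ x, R < ‖x‖ ∧ fderiv ℝ (fderiv ℝ (pressure u)) x ≠ 0 := by
  by_contra! hcon
  have hp := contDiff_pressure hu hc
  set e : Fin n → RSpace n := fun i => EuclideanSpace.single i (1 : ℝ) with he
  have h1 : ∀ x, R < ‖x‖ →
      fderiv ℝ (fun y => fderiv ℝ (𝓕⁻ (pressureSymbol u)) y (e i)) x (e i) = 0 := by
    intro x hx
    have h2 : (fun y => fderiv ℝ (𝓕⁻ (pressureSymbol u)) y (e i))
        = fun y => ((fderiv ℝ (pressure u) y (e i) : ℝ) : ℂ) := by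
      ext y
      rw [← ofReal_pressure hu hc]
      have := (Complex.ofRealCLM.hasFDerivAt.comp y
        (hp.differentiable (by norm_num) y).hasFDerivAt).fderiv
      exact congrArg (fun L => L (e i)) this
    have h3 : HasFDerivAt (fderiv ℝ (pressure u)) (fderiv ℝ (fderiv ℝ (pressure u)) x) x :=
      ((hp.fderiv_right (m := 1) (by norm_num)).differentiable (by norm_num) x).hasFDerivAt
    have h4 := (Complex.ofRealCLM.hasFDerivAt.comp x (h3.clm_apply (hasFDerivAt_const (e i) x)))
    rw [h2]
    have h5 := congrArg (fun L => L (e i)) h4.fderiv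
    refine Eq.trans h5 ?_
    simp [hcon x hx]
  obtain ⟨Q, hQ, hQM⟩ := exists_contDiff_eq_of_fderiv_fderiv_fourierInv_eq_zero
    (measurable_pressureSymbol hu hc).aestronglyMeasurable
    (integrable_pow_mul_pressureSymbol hu hc) (e i) R h1
  set A : Fin n → Fin n → ℝ := fun l k => ∫ y, u y l * u y k with hAdef
  -- The leading term of `Q` at the origin is `vᵢ²` times a function homogeneous of degree zero, and
  -- it must coincide with the quadratic form given by the Hessian of `Q`.
  have hD : ∀ v : RSpace n, v ≠ 0 → fderiv ℝ (fderiv ℝ Q) 0 v v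
      = (2 : ℝ) • (((v i) ^ 2 * ∑ l, ∑ k, rieszSymbol l k v * A l k : ℝ) : ℂ) := by
    intro v hv
    refine fderiv_fderiv_zero_apply_self_of_tendsto hQ ?_
    have h6 := (tendsto_pressureSymbol_smul hu hc v).const_mul (((v i) ^ 2 : ℝ) : ℂ)
    rw [← Complex.ofReal_mul] at h6
    refine h6.congr' ?_
    filter_upwards [self_mem_nhdsWithin] with t ht
    have ht' : (t : ℝ) ≠ 0 := ne_of_gt ht
    have htc : (t : ℂ) ≠ 0 := by exact_mod_cast ht'
    rw [hQM _ (continuousAt_pressureSymbol hu hc (smul_ne_zero ht' hv))]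
    have : inner ℝ (t • v) (e i) = t * v i := by
      simp [he, inner_smul_left, EuclideanSpace.inner_single_right]
    rw [this, Complex.real_smul]
    push_cast
    field_simp
  -- The parallelogram law is the test for being a quadratic form; applied to `eᵢ` and `eⱼ` it reads
  -- `-2(Aᵢᵢ + Aⱼⱼ) = -4Aᵢᵢ`.
  have hsym : ∀ a b : RSpace n, fderiv ℝ (fderiv ℝ Q) 0 (a + b) (a + b)
      + fderiv ℝ (fderiv ℝ Q) 0 (a - b) (a - b)
      = 2 * fderiv ℝ (fderiv ℝ Q) 0 a a + 2 * fderiv ℝ (fderiv ℝ Q) 0 b b := by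
    intro a b
    simp only [map_add, map_sub, add_apply, sub_apply]
    ring
  have hquad : ∀ a b : ℝ, ∑ l, ∑ k, rieszSymbol l k (a • e i + b • e j) * A l k
      = -(a ^ 2 * A i i + a * b * (A i j + A j i) + b ^ 2 * A j j) / (a ^ 2 + b ^ 2) := by
    intro a b
    have hnorm : ‖a • e i + b • e j‖ ^ 2 = a ^ 2 + b ^ 2 := by
      rw [norm_add_sq_real, norm_smul, norm_smul, inner_smul_left, inner_smul_right]
      simp [he, EuclideanSpace.inner_single_right, hij]
    have hterm : ∀ l k, rieszSymbol l k (a • e i + b • e j) * A l k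
        = -(((if l = i then a else 0) + (if l = j then b else 0)) *
          (((if k = i then a else 0) + (if k = j then b else 0)) * A l k)) / (a ^ 2 + b ^ 2) := by
      intro l k
      rw [rieszSymbol, hnorm]
      simp only [he, PiLp.add_apply, PiLp.smul_apply, PiLp.single_apply, smul_eq_mul,
        mul_ite, mul_one, mul_zero]
      ring
    have hsum : ∀ c : Fin n → ℝ,
        ∑ l, ((if l = i then a else 0) + (if l = j then b else 0)) * c l = a * c i + b * c j := by
      intro c
      simp [add_mul, Finset.sum_add_distrib]
    simp only [hterm, ← Finset.sum_div, Finset.sum_neg_distrib, ← Finset.mul_sum, hsum]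
    ring
  have hre : ∀ a b : ℝ, a ^ 2 + b ^ 2 ≠ 0 →
      (fderiv ℝ (fderiv ℝ Q) 0 (a • e i + b • e j) (a • e i + b • e j)).re = 2 * (a ^ 2 *
        (-(a ^ 2 * A i i + a * b * (A i j + A j i) + b ^ 2 * A j j) / (a ^ 2 + b ^ 2))) := by
    intro a b hab
    have hvi : (a • e i + b • e j) i = a := by simp [he, hij]
    have hvj : (a • e i + b • e j) j = b := by simp [he, hij.symm]
    have hv : a • e i + b • e j ≠ 0 := fun h => by
      rw [h] at hvi hvj
      simp only [PiLp.zero_apply] at hvi hvj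
      simp [← hvi, ← hvj] at hab
    rw [hD _ hv, hquad, hvi, Complex.smul_re, Complex.ofReal_re, smul_eq_mul]
  have hs := congrArg Complex.re (hsym (e i) (e j))
  have e1 := hre 1 1 (by norm_num)
  have e2 := hre 1 (-1) (by norm_num)
  have e3 := hre 1 0 (by norm_num)
  have e4 := hre 0 1 (by norm_num)
  simp only [one_smul, neg_smul, zero_smul, add_zero, zero_add, ← sub_eq_add_neg] at e1 e2 e3 e4
  simp only [Complex.add_re, Complex.mul_re, Complex.re_ofNat, Complex.im_ofNat, zero_mul,
    sub_zero, e1, e2, e3, e4] at hs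
  refine hA ?_
  change A i i = A j j
  linarith

end Pressure

/-! ### A compactly supported divergence-free field with anisotropic stress. -/

section StreamFunction

variable {n : ℕ}

/-- The planar rotated gradient `(∂ⱼχ) eᵢ - (∂ᵢχ) eⱼ` of a stream function `χ`. -/
noncomputable def streamField (χ : RSpace n → ℝ) (i j : Fin n) (x : RSpace n) : RSpace n :=
  fderiv ℝ χ x (EuclideanSpace.single j (1 : ℝ)) • EuclideanSpace.single i (1 : ℝ)
    - fderiv ℝ χ x (EuclideanSpace.single i (1 : ℝ)) • EuclideanSpace.single j (1 : ℝ)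

theorem contDiff_streamField {χ : RSpace n → ℝ} (hχ : ContDiff ℝ (⊤ : ℕ∞) χ) (i j : Fin n) :
    ContDiff ℝ (⊤ : ℕ∞) (streamField χ i j) := by
  have h : ContDiff ℝ (⊤ : ℕ∞) (fderiv ℝ χ) := hχ.fderiv_right (by simp)
  exact ((h.clm_apply contDiff_const).smul contDiff_const).sub
    ((h.clm_apply contDiff_const).smul contDiff_const)

theorem hasCompactSupport_streamField {χ : RSpace n → ℝ} (hχ : HasCompactSupport χ)
    (i j : Fin n) : HasCompactSupport (streamField χ i j) :=
  (hχ.fderiv (𝕜 := ℝ)).comp_left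
    (g := fun L : RSpace n →L[ℝ] ℝ => L (EuclideanSpace.single j (1 : ℝ)) •
      (EuclideanSpace.single i (1 : ℝ) : RSpace n)
      - L (EuclideanSpace.single i (1 : ℝ)) • EuclideanSpace.single j (1 : ℝ)) (by simp)

/-- The two mixed second derivatives of `χ` cancel by symmetry. -/
theorem divergence_streamField {χ : RSpace n → ℝ} (hχ : ContDiff ℝ (⊤ : ℕ∞) χ) (i j : Fin n)
    (x : RSpace n) : divergence (streamField χ i j) x = 0 := by
  have h : ContDiff ℝ (⊤ : ℕ∞) (fderiv ℝ χ) := hχ.fderiv_right (by simp)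
  have h1 : HasFDerivAt (fderiv ℝ χ) (fderiv ℝ (fderiv ℝ χ) x) x :=
    (h.differentiable (by simp) x).hasFDerivAt
  have hsymm : IsSymmSndFDerivAt ℝ χ x := hχ.contDiffAt.isSymmSndFDerivAt
    (by simp only [minSmoothness_of_isRCLikeNormedField]; exact WithTop.coe_le_coe.2 le_top)
  have h2 : ∀ a b : RSpace n, HasFDerivAt (fun y => fderiv ℝ χ y a • b)
      (((fderiv ℝ (fderiv ℝ χ) x).flip a).smulRight b) x := fun a b => by
    have := (h1.clm_apply (hasFDerivAt_const a x)).smul_const b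
    simpa using this
  have h3 := (h2 (EuclideanSpace.single j (1 : ℝ)) (EuclideanSpace.single i (1 : ℝ))).sub
    (h2 (EuclideanSpace.single i (1 : ℝ)) (EuclideanSpace.single j (1 : ℝ)))
  have h4 : fderiv ℝ (streamField χ i j) x = _ := h3.fderiv
  rw [divergence, h4]
  simp [Finset.sum_sub_distrib, PiLp.single_apply, Finset.sum_ite_eq']
  rw [hsymm.eq, sub_self]

theorem streamField_apply_left (χ : RSpace n → ℝ) {i j : Fin n} (hij : i ≠ j) (x : RSpace n) :
    streamField χ i j x i = fderiv ℝ χ x (EuclideanSpace.single j (1 : ℝ)) := by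
  simp [streamField, hij]

theorem streamField_apply_right (χ : RSpace n → ℝ) {i j : Fin n} (hij : i ≠ j) (x : RSpace n) :
    streamField χ i j x j = -fderiv ℝ χ x (EuclideanSpace.single i (1 : ℝ)) := by
  simp [streamField, hij.symm]

/-- Otherwise `χ` would be constant on the line through `0` in direction `v`, which leaves the
support. -/
theorem exists_fderiv_apply_ne_zero {E : Type*} [NormedAddCommGroup E] [NormedSpace ℝ E]
    {χ : E → ℝ} (hχ : Differentiable ℝ χ) (hc : HasCompactSupport χ) (h0 : χ 0 ≠ 0)
    {v : E} (hv : v ≠ 0) : ∃ x, fderiv ℝ χ x v ≠ 0 := by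
  by_contra! hcon
  have hd : ∀ t : ℝ, HasDerivAt (fun t : ℝ => χ (t • v)) 0 t := by
    intro t
    have h1 : HasDerivAt (fun t : ℝ => t • v) v t := by
      simpa using (hasDerivAt_id t).smul_const v
    have := (hχ (t • v)).hasFDerivAt.comp_hasDerivAt t h1
    rwa [hcon] at this
  have hconst := is_const_of_deriv_eq_zero (fun t => (hd t).differentiableAt)
    (fun t => (hd t).deriv)
  obtain ⟨R, hR⟩ := hc.isCompact.isBounded.subset_closedBall (0 : E)
  have hv' : 0 < ‖v‖ := norm_pos_iff.2 hv
  set t := (|R| + 1) / ‖v‖ with ht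
  have hz : χ (t • v) = 0 := by
    by_contra hne
    have := hR (subset_tsupport _ hne)
    rw [mem_closedBall_zero_iff, norm_smul, Real.norm_of_nonneg (by positivity), ht,
      div_mul_cancel₀ _ hv'.ne'] at this
    linarith [le_abs_self R]
  have := hconst 0 t
  simp only [zero_smul, hz] at this
  exact h0 this

/-- Linear change of variables; only the positivity of `κ` and its independence of `f` are needed.
-/
theorem exists_pos_integral_comp_eq_mul {E : Type*} [NormedAddCommGroup E] [NormedSpace ℝ E]
    [FiniteDimensional ℝ E] [MeasurableSpace E] [BorelSpace E] (μ : Measure E)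
    [μ.IsAddHaarMeasure] (L : E →L[ℝ] E) (hL : Function.Injective L) :
    ∃ κ : ℝ, 0 < κ ∧ ∀ f : E → ℝ, Continuous f → ∫ x, f (L x) ∂μ = κ * ∫ x, f x ∂μ := by
  have hdet : LinearMap.det (L : E →ₗ[ℝ] E) ≠ 0 := fun h => by
    have := LinearMap.bot_lt_ker_of_det_eq_zero h
    rw [LinearMap.ker_eq_bot.2 hL] at this
    exact lt_irrefl _ this
  refine ⟨|(LinearMap.det (L : E →ₗ[ℝ] E))⁻¹|, abs_pos.2 (inv_ne_zero hdet), fun f hf => ?_⟩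
  have h := Measure.map_linearMap_addHaar_eq_smul_addHaar μ hdet
  have h2 := integral_map (μ := μ) L.continuous.aemeasurable
    (hf.aestronglyMeasurable (μ := μ.map L))
  rw [← h2, show (μ.map L) = _ from h, integral_smul_measure,
    ENNReal.toReal_ofReal (abs_nonneg _), smul_eq_mul]

/-- There is a smooth compactly supported function whose `i`-th and `j`-th partial derivatives
have different `L²` norms. -/
theorem exists_integral_partial_sq_ne {i j : Fin n} (hij : i ≠ j) :
    ∃ χ : RSpace n → ℝ, ContDiff ℝ (⊤ : ℕ∞) χ ∧ HasCompactSupport χ ∧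
      ∫ x, (fderiv ℝ χ x (EuclideanSpace.single i (1 : ℝ))) ^ 2
        ≠ ∫ x, (fderiv ℝ χ x (EuclideanSpace.single j (1 : ℝ))) ^ 2 := by
  set e : Fin n → RSpace n := fun i => EuclideanSpace.single i (1 : ℝ) with he
  let b : ContDiffBump (0 : RSpace n) := ⟨1, 2, one_pos, one_lt_two⟩
  set η : RSpace n → ℝ := fun x => b x with hη
  have hηs : ContDiff ℝ (⊤ : ℕ∞) η := b.contDiff
  have hηc : HasCompactSupport η := b.hasCompactSupport
  have hηd : Differentiable ℝ η := hηs.differentiable (by simp)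
  have hη0 : η 0 ≠ 0 := by
    have h : b 0 = 1 := b.one_of_mem_closedBall (by simp [b])
    exact h.trans_ne one_ne_zero
  have hcont : ∀ m, Continuous fun x => (fderiv ℝ η x (e m)) ^ 2 := fun m =>
    ((hηs.continuous_fderiv (by simp)).clm_apply continuous_const).pow 2
  have hpos : 0 < ∫ x, (fderiv ℝ η x (e i)) ^ 2 := by
    obtain ⟨x, hx⟩ := exists_fderiv_apply_ne_zero hηd hηc hη0 (v := e i) (by simp [he])
    refine (hcont i).integral_pos_of_hasCompactSupport_nonneg_nonzero ?_
      (fun x => sq_nonneg _) (x := x) (pow_ne_zero 2 hx)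
    exact (hηc.fderiv (𝕜 := ℝ)).comp_left (g := fun L : RSpace n →L[ℝ] ℝ => (L (e i)) ^ 2) (by simp)
  by_cases heq : ∫ x, (fderiv ℝ η x (e i)) ^ 2 = ∫ x, (fderiv ℝ η x (e j)) ^ 2
  swap
  · exact ⟨η, hηs, hηc, heq⟩
  -- If the two energies of the bump agree, doubling the `i`-th coordinate separates them: they
  -- become `4κ` and `κ` times the same positive number.
  let L : RSpace n →L[ℝ] RSpace n :=
    ContinuousLinearMap.id ℝ _ + (EuclideanSpace.proj i : RSpace n →L[ℝ] ℝ).smulRight (e i)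
  have hLapp : ∀ x, L x = x + x i • e i := fun x => rfl
  have hLi : L (e i) = (2 : ℝ) • e i := by
    rw [hLapp, show (e i) i = 1 by simp [he], one_smul, two_smul]
  have hLj : L (e j) = e j := by
    rw [hLapp, show (e j) i = 0 by simp [he, hij], zero_smul, add_zero]
  have hLinj : Function.Injective L := by
    rw [injective_iff_map_eq_zero]
    intro x hx
    rw [hLapp] at hx
    have h1 := congrArg (fun y : RSpace n => y i) hx
    simp only [PiLp.add_apply, PiLp.smul_apply, PiLp.zero_apply, smul_eq_mul,
      show (e i) i = 1 by simp [he]] at h1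
    have h2 : x i = 0 := by linarith
    simpa [h2] using hx
  obtain ⟨κ, hκ, hint⟩ := exists_pos_integral_comp_eq_mul volume L hLinj
  have hder : ∀ x v, fderiv ℝ (η ∘ L) x v = fderiv ℝ η (L x) (L v) := fun x v => by
    rw [fderiv_comp x (hηd _) L.differentiableAt, L.fderiv]
    rfl
  refine ⟨η ∘ L, hηs.comp L.contDiff, hηc.comp_isClosedEmbedding
    ((L : RSpace n →ₗ[ℝ] RSpace n).isClosedEmbedding_of_injective (LinearMap.ker_eq_bot.2 hLinj)),
    ?_⟩
  simp only [hder]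
  change ∫ x, (fderiv ℝ η (L x) (L (e i))) ^ 2 ≠ ∫ x, (fderiv ℝ η (L x) (L (e j))) ^ 2
  simp only [hLi, hLj, map_smul, smul_eq_mul, mul_pow]
  rw [integral_const_mul, hint _ (hcont i), hint _ (hcont j), ← heq]
  have := mul_pos hκ hpos
  intro h
  linarith

theorem exists_divergenceFree_integral_sq_ne {i j : Fin n} (hij : i ≠ j) :
    ∃ ψ : RSpace n → RSpace n, ContDiff ℝ (⊤ : ℕ∞) ψ ∧ HasCompactSupport ψ ∧
      (∀ x, divergence ψ x = 0) ∧ ∫ y, ψ y i * ψ y i ≠ ∫ y, ψ y j * ψ y j := by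
  obtain ⟨χ, hχ, hc, hne⟩ := exists_integral_partial_sq_ne hij
  refine ⟨streamField χ i j, contDiff_streamField hχ i j, hasCompactSupport_streamField hc i j,
    divergence_streamField hχ i j, ?_⟩
  simp only [streamField_apply_left χ hij, streamField_apply_right χ hij, ← sq, neg_sq]
  exact hne.symm

end StreamFunction

/-! ### Superposing disjointly supported rescaled copies. -/

section Superposition

theorem sum_eq_zero_or_exists_eq {ι M : Type*} [AddCommMonoid M] (s : Finset ι) (g : ι → M)
    (h : ∀ i ∈ s, ∀ j ∈ s, g i ≠ 0 → g j ≠ 0 → i = j) :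
    ∑ i ∈ s, g i = 0 ∨ ∃ i ∈ s, ∑ i ∈ s, g i = g i := by
  by_cases hz : ∀ i ∈ s, g i = 0
  · exact .inl (Finset.sum_eq_zero hz)
  · push Not at hz
    obtain ⟨i, hi, hgi⟩ := hz
    refine .inr ⟨i, hi, Finset.sum_eq_single_of_mem i hi fun j hj hji => ?_⟩
    by_contra hne
    exact hji (h j hj i hi hne hgi)

theorem norm_sum_le_of_disjoint {ι M : Type*} [NormedAddCommGroup M] (s : Finset ι) (g : ι → M)
    (h : ∀ i ∈ s, ∀ j ∈ s, g i ≠ 0 → g j ≠ 0 → i = j) {K : ℝ} (hK : 0 ≤ K)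
    (hg : ∀ i ∈ s, ‖g i‖ ≤ K) : ‖∑ i ∈ s, g i‖ ≤ K := by
  rcases sum_eq_zero_or_exists_eq s g h with h0 | ⟨i, hi, h0⟩
  · rw [h0, norm_zero]; exact hK
  · rw [h0]; exact hg i hi

theorem sum_mul_sum_of_disjoint {ι : Type*} (s : Finset ι) (g h : ι → ℝ)
    (hd : ∀ i ∈ s, ∀ j ∈ s, i ≠ j → g i * h j = 0) :
    (∑ i ∈ s, g i) * ∑ i ∈ s, h i = ∑ i ∈ s, g i * h i := by
  rw [Finset.sum_mul_sum]
  refine Finset.sum_congr rfl fun i hi => ?_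
  exact Finset.sum_eq_single_of_mem i hi fun j hj hji => hd i hi j hj hji.symm

/-- If `R < ‖x₀‖`, the dilated balls `{x | ‖λʲ x + x₀‖ ≤ R}` are pairwise disjoint for large `λ`. -/
theorem exists_dilation_disjoint {E : Type*} [NormedAddCommGroup E] [NormedSpace ℝ E] (x₀ : E)
    {R : ℝ} (hR : R < ‖x₀‖) :
    ∃ r : ℝ, 1 ≤ r ∧ ∀ (i j : ℕ) (x : E), ‖r ^ i • x + x₀‖ ≤ R → ‖r ^ j • x + x₀‖ ≤ R → i = j := by
  set δ := ‖x₀‖ - R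
  -- On the `j`-th ball, `δ ≤ ‖rʲ x‖ < M`, so a ratio exceeding `M / δ` makes the shells for
  -- different exponents disjoint. The absolute value covers a possibly negative `R`.
  set M := |‖x₀‖ + R| + 1
  have hδ : 0 < δ := sub_pos.2 hR
  have hM : 0 < M := by positivity
  have hr1 : 1 ≤ M / δ + 1 := by linarith [div_pos hM hδ]
  refine ⟨M / δ + 1, hr1, ?_⟩
  have key : ∀ (i j : ℕ) (x : E), i < j → ‖(M / δ + 1) ^ i • x + x₀‖ ≤ R →
      ‖(M / δ + 1) ^ j • x + x₀‖ ≤ R → False := by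
    intro i j x hij hi hj
    set r := M / δ + 1
    have h1 : δ ≤ ‖r ^ i • x‖ := by
      have := norm_sub_norm_le x₀ (-(r ^ i • x))
      rw [sub_neg_eq_add, norm_neg, add_comm] at this
      simp only [δ]; linarith
    have h2 : ‖r ^ j • x‖ < M := by
      have := norm_sub_norm_le (r ^ j • x) (-x₀)
      rw [sub_neg_eq_add, norm_neg] at this
      have := le_abs_self (‖x₀‖ + R)
      simp only [M]; linarith
    have h3 : r * ‖r ^ i • x‖ ≤ ‖r ^ j • x‖ := by
      rw [norm_smul, norm_smul, ← mul_assoc, norm_pow, norm_pow, Real.norm_of_nonneg (by positivity),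
        ← pow_succ']
      exact mul_le_mul_of_nonneg_right (pow_le_pow_right₀ hr1 hij) (norm_nonneg x)
    have h4 : r * δ ≤ r * ‖r ^ i • x‖ := by gcongr
    have h5 : r * δ = M + δ := by simp only [r]; field_simp
    linarith
  intro i j x hi hj
  rcases lt_trichotomy i j with h | h | h
  · exact (key i j x h hi hj).elim
  · exact h
  · exact (key j i x h hj hi).elim

variable {n : ℕ}

/-- The superposition `c ∑_{j < N} r⁻ʲ ψ(rʲ x + x₀)` of rescaled copies of `ψ`. -/
noncomputable def superposition (ψ : RSpace n → RSpace n) (x₀ : RSpace n) (r c : ℝ) (N : ℕ)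
    (x : RSpace n) : RSpace n :=
  ∑ j ∈ Finset.range N, (c * (r ^ j)⁻¹) • ψ (r ^ j • x + x₀)

/-- The chain-rule factor `rʲ` cancels the amplitude `r⁻ʲ`, so all scales have gradients of equal
size. -/
theorem hasFDerivAt_superposition {ψ : RSpace n → RSpace n} (hψ : Differentiable ℝ ψ)
    (x₀ : RSpace n) {r : ℝ} (hr : r ≠ 0) (c : ℝ) (N : ℕ) (x : RSpace n) :
    HasFDerivAt (superposition ψ x₀ r c N)
      (∑ j ∈ Finset.range N, c • fderiv ℝ ψ (r ^ j • x + x₀)) x := by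
  refine HasFDerivAt.fun_sum fun j _ => ?_
  have h1 : HasFDerivAt (fun x : RSpace n => r ^ j • x + x₀)
      (r ^ j • ContinuousLinearMap.id ℝ (RSpace n)) x :=
    ((hasFDerivAt_id x).const_smul (r ^ j)).add_const x₀
  have h2 := ((hψ (r ^ j • x + x₀)).hasFDerivAt.comp x h1).const_smul (c * (r ^ j)⁻¹)
  refine h2.congr_fderiv ?_
  rw [ContinuousLinearMap.comp_smul, ContinuousLinearMap.comp_id, smul_smul, mul_assoc,
    inv_mul_cancel₀ (pow_ne_zero _ hr), mul_one]

theorem contDiff_superposition {ψ : RSpace n → RSpace n} (hψ : ContDiff ℝ (⊤ : ℕ∞) ψ)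
    (x₀ : RSpace n) (r c : ℝ) (N : ℕ) : ContDiff ℝ (⊤ : ℕ∞) (superposition ψ x₀ r c N) :=
  ContDiff.sum fun _ _ =>
    (hψ.comp ((contDiff_id.const_smul _).add contDiff_const)).const_smul _

theorem divergence_superposition {ψ : RSpace n → RSpace n} (hψ : Differentiable ℝ ψ)
    (hdiv : ∀ x, divergence ψ x = 0)
    (x₀ : RSpace n) {r : ℝ} (hr : r ≠ 0) (c : ℝ) (N : ℕ) (x : RSpace n) :
    divergence (superposition ψ x₀ r c N) x = 0 := by
  rw [divergence, (hasFDerivAt_superposition hψ x₀ hr c N x).fderiv]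
  simp only [sum_apply, smul_apply, WithLp.ofLp_sum,
    Finset.sum_apply, PiLp.smul_apply, smul_eq_mul]
  rw [Finset.sum_comm]
  refine Finset.sum_eq_zero fun j _ => ?_
  rw [← Finset.mul_sum]
  exact mul_eq_zero_of_right _ (hdiv _)

theorem superposition_mul_superposition {ψ : RSpace n → RSpace n} {R : ℝ}
    (hsupp : ∀ x, ψ x ≠ 0 → ‖x‖ ≤ R) {x₀ : RSpace n} {r : ℝ}
    (hdisj : ∀ (i j : ℕ) (x : RSpace n), ‖r ^ i • x + x₀‖ ≤ R → ‖r ^ j • x + x₀‖ ≤ R → i = j)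
    (c : ℝ) (N : ℕ) (l k : Fin n) (y : RSpace n) :
    superposition ψ x₀ r c N y l * superposition ψ x₀ r c N y k
      = ∑ j ∈ Finset.range N,
        (c * (r ^ j)⁻¹) ^ 2 * (ψ (r ^ j • y + x₀) l * ψ (r ^ j • y + x₀) k) := by
  simp only [superposition, WithLp.ofLp_sum, Finset.sum_apply, PiLp.smul_apply, smul_eq_mul]
  rw [sum_mul_sum_of_disjoint]
  · exact Finset.sum_congr rfl fun j _ => by ring
  · intro i _ j _ hij
    by_cases hi : ψ (r ^ i • y + x₀) = 0
    · simp [hi]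
    by_cases hj : ψ (r ^ j • y + x₀) = 0
    · simp [hj]
    exact (hij (hdisj i j y (hsupp _ hi) (hsupp _ hj))).elim

theorem norm_fderiv_superposition_le {ψ : RSpace n → RSpace n} (hψ : Differentiable ℝ ψ) {R : ℝ}
    (hsupp : ∀ x, fderiv ℝ ψ x ≠ 0 → ‖x‖ ≤ R) {K : ℝ} (hK : ∀ x, ‖fderiv ℝ ψ x‖ ≤ K)
    {x₀ : RSpace n} {r : ℝ} (hr : r ≠ 0)
    (hdisj : ∀ (i j : ℕ) (x : RSpace n), ‖r ^ i • x + x₀‖ ≤ R → ‖r ^ j • x + x₀‖ ≤ R → i = j)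
    {c : ℝ} (hc : 0 ≤ c) (N : ℕ) (x : RSpace n) :
    ‖fderiv ℝ (superposition ψ x₀ r c N) x‖ ≤ c * K := by
  have hK0 : 0 ≤ K := (norm_nonneg _).trans (hK 0)
  rw [(hasFDerivAt_superposition hψ x₀ hr c N x).fderiv]
  refine norm_sum_le_of_disjoint _ _ (fun i _ j _ hi hj => ?_) (by positivity) fun i _ => ?_
  · exact hdisj i j x (hsupp _ fun h => hi (by rw [h]; exact smul_zero (A := RSpace n →L[ℝ] RSpace n) c))
      (hsupp _ fun h => hj (by rw [h]; exact smul_zero (A := RSpace n →L[ℝ] RSpace n) c))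
  · rw [norm_smul, Real.norm_of_nonneg hc]
    exact mul_le_mul_of_nonneg_left (hK _) hc

theorem norm_superposition_le {ψ : RSpace n → RSpace n} {R : ℝ}
    (hsupp : ∀ x, ψ x ≠ 0 → ‖x‖ ≤ R) {K : ℝ} (hK : ∀ x, ‖ψ x‖ ≤ K)
    {x₀ : RSpace n} {r : ℝ} (hr : 1 ≤ r)
    (hdisj : ∀ (i j : ℕ) (x : RSpace n), ‖r ^ i • x + x₀‖ ≤ R → ‖r ^ j • x + x₀‖ ≤ R → i = j)
    {c : ℝ} (hc : 0 ≤ c) (N : ℕ) (x : RSpace n) :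
    ‖superposition ψ x₀ r c N x‖ ≤ c * K := by
  have hK0 : 0 ≤ K := (norm_nonneg _).trans (hK 0)
  refine norm_sum_le_of_disjoint _ _ (fun i _ j _ hi hj => ?_) (by positivity) fun i _ => ?_
  · exact hdisj i j x (hsupp _ fun h => hi (by rw [h, smul_zero]))
      (hsupp _ fun h => hj (by rw [h, smul_zero]))
  · rw [norm_smul, Real.norm_of_nonneg (by positivity)]
    have h1 : (r ^ i)⁻¹ ≤ 1 := inv_le_one_of_one_le₀ (one_le_pow₀ hr)
    calc c * (r ^ i)⁻¹ * ‖ψ (r ^ i • x + x₀)‖ ≤ c * 1 * K := by gcongr; exact hK _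
      _ = c * K := by ring

/-- As `r ≥ 1`, the supports shrink with `j`; one ball contains them all for every `N`, which makes
the `L²` bound uniform in `N`. -/
theorem superposition_eq_zero {ψ : RSpace n → RSpace n} {R : ℝ}
    (hsupp : ∀ x, ψ x ≠ 0 → ‖x‖ ≤ R) {x₀ : RSpace n} {r : ℝ} (hr : 1 ≤ r) (c : ℝ) (N : ℕ)
    {x : RSpace n} (hx : ‖x₀‖ + R < ‖x‖) : superposition ψ x₀ r c N x = 0 := by
  refine Finset.sum_eq_zero fun j _ => ?_
  by_contra hne
  have h1 := hsupp (r ^ j • x + x₀) fun h => hne (by rw [h, smul_zero])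
  have h2 := norm_sub_norm_le (r ^ j • x) (-x₀)
  rw [sub_neg_eq_add, norm_neg, norm_smul, Real.norm_of_nonneg (by positivity)] at h2
  have h3 : 1 * ‖x‖ ≤ r ^ j * ‖x‖ := by gcongr; exact one_le_pow₀ hr
  linarith

theorem fderiv_fderiv_sum_comp_smul_add {E : Type*} [NormedAddCommGroup E] [NormedSpace ℝ E]
    {p : E → ℝ} (hp : ContDiff ℝ 2 p) (s : Finset ℕ) (b a : ℕ → ℝ) (x₀ x : E) :
    fderiv ℝ (fderiv ℝ (fun x => ∑ j ∈ s, b j * p (a j • x + x₀))) x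
      = ∑ j ∈ s, (b j * a j ^ 2) • fderiv ℝ (fderiv ℝ p) (a j • x + x₀) := by
  have h1 : ∀ j x, HasFDerivAt (fun x : E => a j • x + x₀)
      (a j • ContinuousLinearMap.id ℝ E) x := fun j x =>
    ((hasFDerivAt_id x).const_smul (a j)).add_const x₀
  have h2 : fderiv ℝ (fun x => ∑ j ∈ s, b j * p (a j • x + x₀))
      = fun x => ∑ j ∈ s, (b j * a j) • fderiv ℝ p (a j • x + x₀) := by
    ext1 x
    refine (HasFDerivAt.fun_sum fun j _ => ?_).fderiv
    have h := ((hp.differentiable (by norm_num) (a j • x + x₀)).hasFDerivAt.comp x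
      (h1 j x)).const_mul (b j)
    refine h.congr_fderiv ?_
    rw [ContinuousLinearMap.comp_smul, ContinuousLinearMap.comp_id, smul_smul]
  rw [h2]
  refine (HasFDerivAt.fun_sum fun j _ => ?_).fderiv
  have h := (((hp.fderiv_right (m := 1) (by norm_num)).differentiable (by norm_num)
    (a j • x + x₀)).hasFDerivAt.comp x (h1 j x)).const_smul (b j * a j)
  refine h.congr_fderiv ?_
  rw [ContinuousLinearMap.comp_smul, ContinuousLinearMap.comp_id, smul_smul]
  congr 1
  ring

set_option maxSynthPendingDepth 3 in
theorem norm_smul_fderiv_fderiv {E : Type*} [NormedAddCommGroup E] [NormedSpace ℝ E]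
    (a : ℝ) (p : E → ℝ) (x : E) :
    ‖a • fderiv ℝ (fderiv ℝ p) x‖ = ‖a‖ * ‖fderiv ℝ (fderiv ℝ p) x‖ :=
  norm_smul _ _

/-- The gradient is the derivative composed with the Riesz isometry, which preserves operator norms.
-/
theorem enorm_fderiv_fderiv_le_c1Norm_gradient (p : RSpace n → ℝ) (x : RSpace n) :
    ‖fderiv ℝ (fderiv ℝ p) x‖ₑ ≤ c1Norm (gradient p) := by
  have h : ‖fderiv ℝ (gradient p) x‖ₑ = ‖fderiv ℝ (fderiv ℝ p) x‖ₑ := by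
    have h1 : gradient p = (InnerProductSpace.toDual ℝ (RSpace n)).symm ∘ fderiv ℝ p := rfl
    rw [h1, LinearIsometryEquiv.comp_fderiv]
    rw [← ofReal_norm, ← ofReal_norm]
    congr 1
    exact LinearIsometry.norm_toContinuousLinearMap_comp
      (InnerProductSpace.toDual ℝ (RSpace n)).symm.toLinearIsometry
  rw [← h]
  exact (le_iSup (fun x => ‖fderiv ℝ (gradient p) x‖ₑ) x).trans le_add_self

end Superposition

/-! ### Choice of the parameters and conclusion. -/

theorem mainTheorem7 (n : ℕ) (hn : 2 ≤ n) (ε : ℝ) (hε : 0 < ε) :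
    ∃ u : 𝓢(RSpace n, RSpace n),
      (∀ x, divergence u x = 0) ∧
      eLpNorm (fderiv ℝ u) ∞ volume + eLpNorm u 2 volume ≤ 1 ∧
      ContDiff ℝ 2 (pressure u) ∧
      ENNReal.ofReal (1 / ε) < c1Norm (gradient (pressure u)) := by
  obtain ⟨ψ, hψ, hψc, hψdiv, hne⟩ := exists_divergenceFree_integral_sq_ne
    (i := (⟨0, by omega⟩ : Fin n)) (j := ⟨1, by omega⟩) (by simp [Fin.ext_iff])
  have hψd : Differentiable ℝ ψ := hψ.differentiable (by simp)
  obtain ⟨R, hR⟩ := hψc.isCompact.isBounded.subset_closedBall (0 : RSpace n)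
  have hsupp : ∀ x, ψ x ≠ 0 → ‖x‖ ≤ R := fun x hx =>
    mem_closedBall_zero_iff.1 (hR (subset_tsupport _ hx))
  have hsupp' : ∀ x, fderiv ℝ ψ x ≠ 0 → ‖x‖ ≤ R := fun x hx =>
    mem_closedBall_zero_iff.1 (hR (support_fderiv_subset ℝ hx))
  obtain ⟨K₁, hK₁⟩ := hψ.continuous.bounded_above_of_compact_support hψc
  obtain ⟨K₂, hK₂⟩ := (hψ.continuous_fderiv (by simp)).bounded_above_of_compact_support
    (hψc.fderiv (𝕜 := ℝ))
  obtain ⟨x₀, hx₀, hD⟩ := exists_fderiv_fderiv_pressure_ne_zero hψ hψc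
    (by simp [Fin.ext_iff]) hne R
  obtain ⟨r, hr, hdisj⟩ := exists_dilation_disjoint x₀ hx₀
  have hr0 : r ≠ 0 := by positivity
  have hrpos : ∀ j : ℕ, 0 < r ^ j := fun j => by positivity
  have hK₁0 : 0 ≤ K₁ := (norm_nonneg _).trans (hK₁ 0)
  have hK₂0 : 0 ≤ K₂ := (norm_nonneg _).trans (hK₂ 0)
  set S : Set (RSpace n) := Metric.closedBall 0 (‖x₀‖ + R)
  have hSfin : volume S ≠ ∞ := measure_closedBall_lt_top.ne
  set V : ℝ := (volume S ^ (1 / (2 : ℝ≥0∞).toReal)).toReal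
  have hVne : volume S ^ (1 / (2 : ℝ≥0∞).toReal) ≠ ∞ :=
    ENNReal.rpow_ne_top_of_nonneg (by positivity) hSfin
  have hV0 : 0 ≤ V := ENNReal.toReal_nonneg
  -- The bounds `c K₂` for the gradient and `c K₁ V` for the `L²` norm then add up to at most `1`;
  -- the summand `1` keeps the inverse meaningful. Since `c` does not involve `N`, the number of
  -- scales can be chosen afterwards.
  set c : ℝ := (K₂ + K₁ * V + 1)⁻¹ with hcdef
  have hcpos : 0 < c := by positivity
  set d : ℝ := ‖fderiv ℝ (fderiv ℝ (pressure ψ)) x₀‖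
  have hd : 0 < d := norm_pos_iff (a := fderiv ℝ (fderiv ℝ (pressure ψ)) x₀) |>.2 hD
  obtain ⟨N, hN⟩ := exists_nat_gt ((1 / ε) / (c ^ 2 * d))
  set w := superposition ψ x₀ r c N with hw
  have hwc : HasCompactSupport w :=
    HasCompactSupport.intro (isCompact_closedBall (0 : RSpace n) (‖x₀‖ + R)) fun x hx =>
      superposition_eq_zero hsupp hr c N (by simpa using hx)
  have hws : ContDiff ℝ (⊤ : ℕ∞) w := contDiff_superposition hψ x₀ r c N
  have hp := contDiff_pressure hψ hψc
  have hpw : pressure w = fun x => ∑ j ∈ Finset.range N,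
      (c * (r ^ j)⁻¹) ^ 2 * pressure ψ (r ^ j • x + x₀) :=
    funext fun x => pressure_eq_sum_of_mul_eq_sum _ hψ hψc _ _ hrpos x₀
      (superposition_mul_superposition hsupp hdisj c N) x
  refine ⟨hwc.toSchwartzMap hws, divergence_superposition hψd hψdiv x₀ hr0 c N, ?_,
    contDiff_pressure hws hwc, ?_⟩
  · change eLpNorm (fderiv ℝ w) ∞ volume + eLpNorm w 2 volume ≤ 1
    have h1 : eLpNorm (fderiv ℝ w) ∞ volume ≤ ENNReal.ofReal (c * K₂) := by
      rw [eLpNorm_exponent_top]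
      exact eLpNormEssSup_le_of_ae_bound (.of_forall
        (norm_fderiv_superposition_le hψd hsupp' hK₂ hr0 hdisj hcpos.le N))
    have h2 : eLpNorm w 2 volume ≤ ENNReal.ofReal (c * K₁ * V) := by
      have h3 : eLpNorm w 2 volume ≤ eLpNorm (S.indicator fun _ => c * K₁) 2 volume := by
        refine eLpNorm_mono fun x => ?_
        by_cases hx : x ∈ S
        · rw [Set.indicator_of_mem hx, Real.norm_of_nonneg (by positivity)]
          exact norm_superposition_le hsupp hK₁ hr hdisj hcpos.le N x
        · rw [hw, superposition_eq_zero hsupp hr c N (by simpa [S] using hx), norm_zero]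
          exact norm_nonneg _
      refine h3.trans_eq ?_
      rw [eLpNorm_indicator_const Metric.isClosed_closedBall.measurableSet (by norm_num)
        (by norm_num), ENNReal.ofReal_mul (by positivity), ENNReal.ofReal_toReal hVne,
        Real.enorm_of_nonneg (by positivity)]
    refine (add_le_add h1 h2).trans ?_
    rw [← ENNReal.ofReal_add (by positivity) (by positivity), ENNReal.ofReal_le_one]
    have h4 : c * (K₂ + K₁ * V + 1) = 1 := inv_mul_cancel₀ (by positivity)
    nlinarith
  · change _ < c1Norm (gradient (pressure w))
    refine lt_of_lt_of_le ?_ (enorm_fderiv_fderiv_le_c1Norm_gradient (pressure w) 0)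
    rw [hpw, fderiv_fderiv_sum_comp_smul_add hp]
    -- At the origin every argument `rʲ x + x₀` equals `x₀`, and the squared amplitude `c² r⁻²ʲ`
    -- cancels the factor `r²ʲ` from two derivatives, so all `N` terms coincide.
    have h5 : ∑ j ∈ Finset.range N, ((c * (r ^ j)⁻¹) ^ 2 * (r ^ j) ^ 2) •
        fderiv ℝ (fderiv ℝ (pressure ψ)) (r ^ j • (0 : RSpace n) + x₀)
        = (N * c ^ 2) • fderiv ℝ (fderiv ℝ (pressure ψ)) x₀ := by
      have h6 : ∀ j, (c * (r ^ j)⁻¹) ^ 2 * (r ^ j) ^ 2 = c ^ 2 := fun j => by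
        have := (hrpos j).ne'
        field_simp
      simp only [h6, smul_zero, zero_add, Finset.sum_const, Finset.card_range]
      rw [← Nat.cast_smul_eq_nsmul ℝ, smul_smul]
    have h6 : ‖(N * c ^ 2) • fderiv ℝ (fderiv ℝ (pressure ψ)) x₀‖ = ‖N * c ^ 2‖ * d :=
      norm_smul_fderiv_fderiv _ _ _
    rw [h5, ← ofReal_norm, h6, Real.norm_of_nonneg (by positivity)]
    rw [div_lt_iff₀ (by positivity)] at hN
    refine (ENNReal.ofReal_lt_ofReal_iff_of_nonneg (by positivity)).2 ?_
    linarith
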